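/- **Theorem (lower bound for depolarizing vs unitary channel, incoherent access).** A learning algorithm with incoherent access that makes $T$ calls to an unknown quantum channel $\mathcal{E}$ on $\mathbb{M}_d$, with an ancilla system of arbitrary dimension $d'$, proceeds in $T$ rounds. In each round it prepares a (possibly mixed) state $\rho$ on $\mathbb{C}^d\otimes\mathbb{C}^{d'}$, applies $\mathcal{E}\otimes\mathcal{I}_{\mathrm{anc}}$, and measures a POVM with finitely many outcomes on $\mathbb{C}^d\otimes\mathbb{C}^{d'}$; the state and the POVM of a round may depend on all previous outcomes. After the last round it outputs a (possibly randomized) guess depending on all outcomes. Suppose that, with probability $1/2$ each, $\mathcal{E}$ is either the completely depolarizing channel $\mathcal{D}(\rho)=\operatorname{tr}(\rho)\,I/d$, or the unitary channel $\mathcal{U}(\rho)=U\rho U^\dagger$ for a Haar-random unitary $U\in\mathbb{U}_d$ (drawn once and fixed for all calls). Then every such algorithm that guesses correctly which of the two cases holds with probability at least $2/3$ must make $T\ge\Omega(\sqrt d)$ calls to $\mathcal{E}$: there is a universal constant $c>0$, independent of $d$, $d'$, $T$ and the algorithm, such that $T\ge c\sqrt d$. -/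

import Mathlib

open MeasureTheory
open scoped Matrix Kronecker ComplexOrder

/-! ### States, measurements and channels on `ℂ^d ⊗ ℂ^d'` -/

/-- A (possibly mixed) quantum state on a system with index set `ι`: a positive semidefinite
matrix of trace one. -/
structure QState (ι : Type) [Fintype ι] where
  mat : Matrix ι ι ℂ
  posSemidef : mat.PosSemidef
  trace_eq_one : mat.trace = 1

/-- A POVM with `m` outcomes on a system with index set `ι`. -/
structure POVM (ι : Type) [Fintype ι] [DecidableEq ι] (m : ℕ) where
  effect : Fin m → Matrix ι ι ℂ
  posSemidef : ∀ v, (effect v).PosSemidef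
  sum_eq_one : ∑ v, effect v = 1

/-- Linear maps `𝕄_d → 𝕄_d`, among them the quantum channels. -/
abbrev SuperOp (d : ℕ) : Type :=
  Matrix (Fin d) (Fin d) ℂ →ₗ[ℂ] Matrix (Fin d) (Fin d) ℂ

/-- The map `E ⊗ I_anc` on `ℂ^d ⊗ ℂ^d'`: for every pair `(i, j)` of ancilla basis vectors, `E` is
applied to the `(i, j)` block `(X_{(a,i),(b,j)})_{a,b}`. -/
def SuperOp.extend {d : ℕ} (E : SuperOp d) (d' : ℕ)
    (X : Matrix (Fin d × Fin d') (Fin d × Fin d') ℂ) :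
    Matrix (Fin d × Fin d') (Fin d × Fin d') ℂ :=
  Matrix.of fun p q => E (Matrix.of fun a b => X (a, p.2) (b, q.2)) p.1 q.1

/-- `E ⊗ I_anc` acts on product operators as it should. -/
theorem SuperOp.extend_kronecker {d : ℕ} (E : SuperOp d) (d' : ℕ)
    (A : Matrix (Fin d) (Fin d) ℂ) (B : Matrix (Fin d') (Fin d') ℂ) :
    E.extend d' (A ⊗ₖ B) = E A ⊗ₖ B := by
  ext ⟨a, i⟩ ⟨b, j⟩
  have h : (Matrix.of fun a b => (A ⊗ₖ B) (a, i) (b, j)) = B i j • A := by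
    ext a b
    simp [Matrix.kroneckerMap_apply, mul_comm]
  change E (Matrix.of fun a b => (A ⊗ₖ B) (a, i) (b, j)) a b = E A a b * B i j
  rw [h, map_smul, Matrix.smul_apply, smul_eq_mul, mul_comm]

/-- The completely depolarizing channel `ρ ↦ tr(ρ) I / d`. -/
noncomputable def depolarizing (d : ℕ) : SuperOp d where
  toFun ρ := (ρ.trace / (d : ℂ)) • (1 : Matrix (Fin d) (Fin d) ℂ)
  map_add' ρ σ := by rw [Matrix.trace_add, add_div, add_smul]
  map_smul' c ρ := by
    rw [Matrix.trace_smul, smul_eq_mul, mul_div_assoc, mul_smul, RingHom.id_apply]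

/-- The unitary channel `ρ ↦ U ρ U†`. -/
noncomputable def unitaryChannel {d : ℕ} (U : Matrix.unitaryGroup (Fin d) ℂ) : SuperOp d where
  toFun ρ := (U : Matrix (Fin d) (Fin d) ℂ) * ρ * (U : Matrix (Fin d) (Fin d) ℂ)ᴴ
  map_add' ρ σ := by rw [mul_add, add_mul]
  map_smul' c ρ := by rw [Matrix.mul_smul, Matrix.smul_mul, RingHom.id_apply]

/-! ### Haar measure on the unitary group -/

instance unitaryGroupCompactSpace (d : ℕ) : CompactSpace (Matrix.unitaryGroup (Fin d) ℂ) := by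
  refine isCompact_iff_compactSpace.mp ?_
  have hK : IsCompact (Set.pi Set.univ fun _ : Fin d => Set.pi Set.univ fun _ : Fin d =>
      Metric.closedBall (0 : ℂ) 1) :=
    isCompact_univ_pi fun _ => isCompact_univ_pi fun _ => isCompact_closedBall 0 1
  refine hK.of_isClosed_subset ?_ ?_
  · exact isClosed_unitary (R := Matrix (Fin d) (Fin d) ℂ)
  · intro U hU i _ j _
    rw [mem_closedBall_zero_iff]
    exact entry_norm_bound_of_unitary hU i j

noncomputable instance unitaryGroupMeasurableSpace (d : ℕ) :
    MeasurableSpace (Matrix.unitaryGroup (Fin d) ℂ) := borel _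

instance unitaryGroupBorelSpace (d : ℕ) : BorelSpace (Matrix.unitaryGroup (Fin d) ℂ) := ⟨rfl⟩

/-- The Haar probability measure on the unitary group. -/
noncomputable def haarUnitary (d : ℕ) : Measure (Matrix.unitaryGroup (Fin d) ℂ) :=
  Measure.haarMeasure ⊤

instance haarUnitary_isProbabilityMeasure (d : ℕ) : IsProbabilityMeasure (haarUnitary d) :=
  ⟨Measure.haarMeasure_self (K₀ := (⊤ : TopologicalSpace.PositiveCompacts _))⟩

/-! ### Learning algorithms with incoherent access -/

/-- An adaptive, ancilla-assisted learning algorithm with incoherent access that makes `T` calls,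
as a rooted tree of depth `T`: at each inner node a state on `ℂ^d ⊗ ℂ^d'` is prepared, the unknown
channel is applied to the main system `ℂ^d`, and a POVM is measured on both systems. The outcomes
`v` label the children of the node, so that each further choice may depend on all previous
outcomes. -/
inductive LearningTree (d d' : ℕ) : ℕ → Type
  | leaf : LearningTree d d' 0
  | node {T m : ℕ} (ρ : QState (Fin d × Fin d')) (F : POVM (Fin d × Fin d') m)
      (child : Fin m → LearningTree d d' T) : LearningTree d d' (T + 1)

namespace LearningTree

/-- The leaves of the tree, i.e. the complete sequences of measurement outcomes. -/
def Leaf {d d' : ℕ} : {T : ℕ} → LearningTree d d' T → Type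
  | _, leaf => Unit
  | _, node (m := m) _ _ child => Σ v : Fin m, Leaf (child v)

instance instFintypeLeaf {d d' : ℕ} : {T : ℕ} → (t : LearningTree d d' T) → Fintype t.Leaf
  | _, leaf => inferInstanceAs (Fintype Unit)
  | _, node (m := m) _ _ child =>
    haveI : ∀ v, Fintype (child v).Leaf := fun v => instFintypeLeaf (child v)
    inferInstanceAs (Fintype (Σ v : Fin m, Leaf (child v)))

/-- The probability `p^E(ℓ)` of reaching the leaf `ℓ` if the unknown channel is `E`: the product
along the path from the root to `ℓ` of the outcome probabilities `tr(F_v (E ⊗ I_anc)(ρ))`. -/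
noncomputable def leafProb {d d' : ℕ} (E : SuperOp d) :
    {T : ℕ} → (t : LearningTree d d' T) → t.Leaf → ℝ
  | _, leaf, _ => 1
  | _, node ρ F child, l =>
    (F.effect l.1 * E.extend d' ρ.mat).trace.re * leafProb E (child l.1) l.2

/-- The success probability in the task of telling the completely depolarizing channel from a
Haar-random unitary channel, either being the case with probability `1/2`. At the leaf `l` the
algorithm answers "unitary" with probability `guess l`, and "depolarizing" otherwise. -/
noncomputable def successProb {d d' T : ℕ} (t : LearningTree d d' T)
    (guess : t.Leaf → unitInterval) : ℝ :=
  1 / 2 * ∑ l, t.leafProb (depolarizing d) l * (1 - (guess l : ℝ)) +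
    1 / 2 * ∫ U, ∑ l, t.leafProb (unitaryChannel U) l * (guess l : ℝ) ∂(haarUnitary d)

end LearningTree

/-! Fix a leaf. Writing effects as Bᴴ B and states as A Aᴴ, its probability under a unitary `U` is a
sum of terms |f(U)|², where f = l₁ ⋯ l_T is a product of linear forms in the entries of `U`. Under
the depolarizing channel it is d^(-T) times the corresponding sum of ∏ ‖l_i‖²
(`exists_linear_forms`). It therefore suffices to bound the Haar integral of |f|² below by ∏ ‖l_i‖²
/ (d(d+1)⋯(d+T-1)).

The Fischer inner product mediates. Multiplication by l raises the squared Fischer norm by a factor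
of at least ‖l‖² (`le_fischer_linForm_mul`), and in degree T the squared Fischer norm is at most
d(d+1)⋯(d+T-1) times the squared Haar norm (`fischer_self_le`). The latter follows by induction on
the degree from a gradient estimate (`sum_haarNormSq_pderiv_le`). The gradient energy is the
quadratic form of the Casimir operator, which in degree T is dT plus twice the sum, over pairs of
factors, of the swaps of their column indices. It thus multiplies coefficient sums by at most
T(d+T-1). As it is symmetric for the Haar inner product, this crude bound on all its powers yields
the same bound on its quadratic form (`re_haarInner_casimir_le`).

Hence at every leaf the averaged unitary probability is at least 1 - T²/d times the depolarizing one
(`leafProb_depolarizing_le`). This one-sided bound caps the success probability at 1/2 + T²/(2d). -/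

/-! ### Polynomials in the entries of a matrix -/

/-- Polynomials in the entries of a `d × d` matrix. -/
abbrev MatPoly (d : ℕ) : Type := MvPolynomial (Fin d × Fin d) ℂ

namespace MatPoly

open MvPolynomial ComplexConjugate

variable {d : ℕ}

/-- The value of a polynomial at a matrix. -/
noncomputable def evalAt (Z : Matrix (Fin d) (Fin d) ℂ) : MatPoly d →+* ℂ :=
  MvPolynomial.eval fun x => Z x.1 x.2

@[simp] lemma evalAt_X (Z : Matrix (Fin d) (Fin d) ℂ) (x : Fin d × Fin d) :
    evalAt Z (X x) = Z x.1 x.2 := by simp [evalAt]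

@[simp] lemma evalAt_C (Z : Matrix (Fin d) (Fin d) ℂ) (c : ℂ) : evalAt Z (C c) = c := by
  simp [evalAt]

@[simp] lemma evalAt_smul (Z : Matrix (Fin d) (Fin d) ℂ) (c : ℂ) (f : MatPoly d) :
    evalAt Z (c • f) = c * evalAt Z f := by simp [evalAt]

/-- The derivation generating the right translations `Z ↦ Z exp (t A)`. -/
noncomputable def rightDeriv (A : Matrix (Fin d) (Fin d) ℂ) :
    Derivation ℂ (MatPoly d) (MatPoly d) :=
  mkDerivation ℂ fun x => ∑ m, C (A m x.2) * X (x.1, m)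

lemma rightDeriv_X (A : Matrix (Fin d) (Fin d) ℂ) (x : Fin d × Fin d) :
    rightDeriv A (X x) = ∑ m, C (A m x.2) * X (x.1, m) :=
  mkDerivation_X _ _ _

lemma rightDeriv_add (A B : Matrix (Fin d) (Fin d) ℂ) :
    rightDeriv (A + B) = rightDeriv A + rightDeriv B := by
  refine derivation_ext fun x => ?_
  simp [rightDeriv_X, add_mul, Finset.sum_add_distrib]

lemma rightDeriv_smul (c : ℂ) (A : Matrix (Fin d) (Fin d) ℂ) :
    rightDeriv (c • A) = c • rightDeriv A := by
  refine derivation_ext fun x => ?_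
  simp [rightDeriv_X, Finset.smul_sum, smul_eq_C_mul, mul_assoc]

/-- The right-translation derivation attached to the matrix unit `e_{ij}`. -/
noncomputable def unitDeriv (i j : Fin d) : Derivation ℂ (MatPoly d) (MatPoly d) :=
  rightDeriv (Matrix.single i j 1)

lemma unitDeriv_X (i j a b : Fin d) :
    unitDeriv i j (X (a, b)) = if j = b then X (a, i) else 0 := by
  rw [unitDeriv, rightDeriv_X]
  split_ifs with h
  · rw [Finset.sum_eq_single i] <;> simp +contextual [h, eq_comm]
  · exact Finset.sum_eq_zero fun m _ => by simp [h]

lemma derivation_sum_apply {ι : Type*} (s : Finset ι)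
    (D : ι → Derivation ℂ (MatPoly d) (MatPoly d)) (f : MatPoly d) :
    (∑ k ∈ s, D k) f = ∑ k ∈ s, D k f := by
  exact (congrFun (map_sum Derivation.coeFnAddMonoidHom D s) f).trans (Finset.sum_apply _ _ _)

lemma unitDeriv_eq_sum (i j : Fin d) (f : MatPoly d) :
    unitDeriv i j f = ∑ k, X (k, i) * pderiv (k, j) f := by
  have h : unitDeriv i j = ∑ k, (X (k, i) : MatPoly d) • pderiv (R := ℂ) (k, j) := by
    refine derivation_ext fun x => ?_
    obtain ⟨a, b⟩ := x
    rw [unitDeriv_X, derivation_sum_apply, Finset.sum_eq_single a]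
    · simp [pderiv_X, Pi.single_apply, eq_comm]
    · intro k _ hk
      simp [pderiv_X, Ne.symm hk]
    · simp
  rw [h, derivation_sum_apply]
  simp

/-- The Casimir operator `∑ e_{ji} e_{ij}` of the right translations. -/
noncomputable def casimir : MatPoly d →ₗ[ℂ] MatPoly d :=
  ∑ i, ∑ j, (unitDeriv j i).toLinearMap ∘ₗ (unitDeriv i j).toLinearMap

lemma casimir_apply (f : MatPoly d) :
    casimir f = ∑ i, ∑ j, unitDeriv j i (unitDeriv i j f) := by
  simp [casimir, LinearMap.sum_apply]

/-- The polarized part of the Casimir operator on a product `X_{ab} g`. -/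
noncomputable def exchange (a b : Fin d) (g : MatPoly d) : MatPoly d :=
  ∑ i, X (a, i) * unitDeriv b i g

/-- By this recursion, `exchange a b g` is a sum over the factors of `g`: each term is X_{ab} g with
the column index b swapped with that of the factor. -/
lemma exchange_X_mul (a b c e : Fin d) (h : MatPoly d) :
    exchange a b (X (c, e) * h) = X (a, e) * (X (c, b) * h) + X (c, e) * exchange a b h := by
  have : ∀ i, X (a, i) * unitDeriv b i (X (c, e) * h) =
      (if i = e then X (a, i) * (X (c, b) * h) else 0) + X (c, e) * (X (a, i) * unitDeriv b i h) := by
    intro i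
    rw [Derivation.leibniz, unitDeriv_X, smul_eq_mul, smul_eq_mul]
    split_ifs <;> ring
  simp only [exchange, this, Finset.sum_add_distrib, Finset.mul_sum]
  simp

/-- The Casimir operator is second order. Both derivatives falling on X_{ab} give the factor d, both
falling on `g` give `casimir g`, and the two mixed terms coincide after renaming the summation
index. -/
lemma casimir_X_mul (a b : Fin d) (g : MatPoly d) :
    casimir (X (a, b) * g) =
      (d : ℂ) • (X (a, b) * g) + X (a, b) * casimir g + (2 : ℂ) • exchange a b g := by
  have h1 : ∀ i j, unitDeriv j i (unitDeriv i j (X (a, b) * g)) =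
      X (a, b) * unitDeriv j i (unitDeriv i j g) +
        (if i = b then X (a, j) * unitDeriv i j g else 0) +
        (if j = b then X (a, i) * unitDeriv j i g + X (a, j) * g else 0) := by
    intro i j
    rw [Derivation.leibniz, unitDeriv_X, smul_eq_mul, smul_eq_mul, map_add, Derivation.leibniz,
      Derivation.leibniz, unitDeriv_X]
    split_ifs with h h' h'
    all_goals simp only [smul_eq_mul, unitDeriv_X, if_true, mul_zero, map_zero]
    all_goals ring
  have h2 : (d : ℂ) • (X (a, b) * g) = ∑ _i : Fin d, X (a, b) * g := by
    simp [smul_eq_C_mul]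
  rw [casimir_apply, casimir_apply, h2, two_smul, exchange]
  simp only [h1, Finset.sum_add_distrib, Finset.mul_sum]
  rw [Finset.sum_comm (f := fun i j => if i = b then X (a, j) * unitDeriv i j g else 0)]
  simp only [Finset.sum_ite_eq', Finset.mem_univ, if_true, Finset.sum_add_distrib]
  ring

/-- `f` is a combination of products of `T` matrix entries, with coefficients of total absolute
value at most `r`. -/
inductive MonomialBound : ℕ → ℝ → MatPoly d → Prop
  | one : MonomialBound 0 1 1
  | X_mul {T : ℕ} {r : ℝ} {f : MatPoly d} (x : Fin d × Fin d) :
      MonomialBound T r f → MonomialBound (T + 1) r (X x * f)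
  | zero {T : ℕ} : MonomialBound T 0 0
  | add {T : ℕ} {r s : ℝ} {f g : MatPoly d} :
      MonomialBound T r f → MonomialBound T s g → MonomialBound T (r + s) (f + g)
  | smul {T : ℕ} {r : ℝ} {f : MatPoly d} (c : ℂ) :
      MonomialBound T r f → MonomialBound T (‖c‖ * r) (c • f)

/-! ### Coefficient bounds for the Casimir operator and the derivatives -/

namespace MonomialBound

variable {T : ℕ} {r s : ℝ} {f g : MatPoly d}

lemma of_eq (h : MonomialBound T r f) (hr : r = s) : MonomialBound T s f := hr ▸ h

lemma exchange (a b : Fin d) (h : MonomialBound T r f) :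
    MonomialBound (T + 1) (T * r) (exchange a b f) := by
  induction h with
  | one => simpa [MatPoly.exchange] using (MonomialBound.zero : MonomialBound (d := d) 1 0 0)
  | @X_mul T r f x h ih =>
    obtain ⟨c, e⟩ := x
    rw [exchange_X_mul]
    exact ((X_mul _ (X_mul _ h)).add (X_mul _ ih)).of_eq (by push_cast; ring)
  | zero => simpa [MatPoly.exchange] using MonomialBound.zero
  | add _ _ ih ih' =>
    have := ih.add ih'
    simp only [MatPoly.exchange, map_add, mul_add, Finset.sum_add_distrib] at this ⊢
    exact this.of_eq (by ring)
  | smul c _ ih =>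
    have := ih.smul c
    simp only [MatPoly.exchange, Derivation.map_smul, mul_smul_comm, Finset.smul_sum] at this ⊢
    exact this.of_eq (by ring)

lemma casimir (h : MonomialBound T r f) :
    MonomialBound T (T * (d + T - 1) * r) (casimir f) := by
  induction h with
  | one => simpa [casimir_apply] using (MonomialBound.zero : MonomialBound (d := d) 0 0 0)
  | @X_mul T r f x h ih =>
    obtain ⟨a, b⟩ := x
    rw [casimir_X_mul]
    refine ((((X_mul (a, b) h).smul (d : ℂ)).add (X_mul _ ih)).add
      ((h.exchange a b).smul 2)).of_eq ?_
    -- The constants add up by d + T(d+T-1) + 2T = (T+1)(d+T).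
    simp only [Complex.norm_natCast, Complex.norm_ofNat]
    push_cast
    ring
  | zero => simpa using MonomialBound.zero
  | add _ _ ih ih' =>
    rw [map_add]
    exact (ih.add ih').of_eq (by ring)
  | smul c _ ih =>
    rw [map_smul]
    exact (ih.smul c).of_eq (by ring)

lemma casimir_iterate (h : MonomialBound T r f) (n : ℕ) :
    MonomialBound T ((T * (d + T - 1) : ℝ) ^ n * r) (MatPoly.casimir^[n] f) := by
  induction n with
  | zero => simpa using h
  | succ n ih =>
    rw [Function.iterate_succ_apply']
    exact ih.casimir.of_eq (by ring)

lemma exists_eq_C (h : MonomialBound 0 r f) : ∃ c, f = C c := by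
  generalize hT : 0 = T at h
  induction h with
  | one => exact ⟨1, by simp⟩
  | X_mul => simp at hT
  | zero => exact ⟨0, by simp⟩
  | add _ _ ih ih' =>
    obtain ⟨c, rfl⟩ := ih hT
    obtain ⟨c', rfl⟩ := ih' hT
    exact ⟨c + c', by simp⟩
  | smul a _ ih =>
    obtain ⟨c, rfl⟩ := ih hT
    exact ⟨a * c, by simp [smul_eq_C_mul]⟩

/-- Only the degree matters here: `s` is left unspecified because the later norm estimates do not
depend on the coefficient bound. -/
lemma exists_pderiv (h : MonomialBound T r f) (x : Fin d × Fin d) (k : ℕ) (hk : T = k + 1) :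
    ∃ s, MonomialBound k s (pderiv x f) := by
  induction h generalizing k with
  | one => simp at hk
  | @X_mul T r f y h ih =>
    obtain rfl : T = k := by simpa using hk
    have h1 : ∃ s, MonomialBound T s (X y * pderiv x f) := by
      cases T with
      | zero =>
        obtain ⟨c, rfl⟩ := h.exists_eq_C
        exact ⟨0, by simpa using MonomialBound.zero⟩
      | succ k =>
        obtain ⟨s, hs⟩ := ih k rfl
        exact ⟨s, hs.X_mul y⟩
    obtain ⟨s, hs⟩ := h1
    refine ⟨s + ‖(if x = y then 1 else 0 : ℂ)‖ * r, ?_⟩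
    · convert hs.add (h.smul (if x = y then 1 else 0)) using 1
      rw [Derivation.leibniz, pderiv_X]
      by_cases hxy : x = y
      · subst hxy; simp
      · simp [hxy, Ne.symm hxy]
  | zero => exact ⟨0, by simpa using MonomialBound.zero⟩
  | add _ _ ih ih' =>
    obtain ⟨s, hs⟩ := ih k hk
    obtain ⟨s', hs'⟩ := ih' k hk
    exact ⟨_, by simpa using hs.add hs'⟩
  | smul c _ ih =>
    obtain ⟨s, hs⟩ := ih k hk
    exact ⟨_, by simpa using hs.smul c⟩

lemma norm_evalAt_le (h : MonomialBound T r f) {Z : Matrix (Fin d) (Fin d) ℂ}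
    (hZ : ∀ i j, ‖Z i j‖ ≤ 1) : ‖evalAt Z f‖ ≤ r := by
  induction h with
  | one => simp
  | X_mul x _ ih =>
    rw [map_mul, norm_mul, evalAt_X]
    exact (mul_le_of_le_one_left (norm_nonneg _) (hZ _ _)).trans ih
  | zero => simp
  | add _ _ ih ih' =>
    rw [map_add]
    exact (norm_add_le _ _).trans (add_le_add ih ih')
  | smul c _ ih =>
    rw [evalAt_smul, norm_mul]
    exact mul_le_mul_of_nonneg_left ih (norm_nonneg _)

end MonomialBound

/-- The linear form with coefficients `l`. -/
noncomputable def linForm (l : Fin d × Fin d → ℂ) : MatPoly d := ∑ x, l x • X x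

lemma evalAt_linForm (Z : Matrix (Fin d) (Fin d) ℂ) (l : Fin d × Fin d → ℂ) :
    evalAt Z (linForm l) = ∑ x, l x * Z x.1 x.2 := by
  simp [linForm]

lemma MonomialBound.exists_linForm_mul {T : ℕ} {r : ℝ} {f : MatPoly d} (h : MonomialBound T r f)
    (l : Fin d × Fin d → ℂ) : ∃ s, MonomialBound (T + 1) s (linForm l * f) := by
  rw [linForm, Finset.sum_mul]
  refine Finset.sum_induction _ (fun g => ∃ s, MonomialBound (T + 1) s g) ?_ ⟨0, .zero⟩ ?_
  · rintro _ _ ⟨s, hs⟩ ⟨s', hs'⟩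
    exact ⟨_, hs.add hs'⟩
  · intro x _
    rw [smul_mul_assoc]
    exact ⟨_, (h.X_mul x).smul _⟩

/-! ### The Fischer inner product -/

/-- The Fischer inner product of homogeneous polynomials of degree `T`. -/
noncomputable def fischer : ℕ → MatPoly d → MatPoly d → ℂ
  | 0, f, g => evalAt 0 f * conj (evalAt 0 g)
  | T + 1, f, g => ((T : ℂ) + 1)⁻¹ * ∑ x, fischer T (pderiv x f) (pderiv x g)

lemma fischer_succ (T : ℕ) (f g : MatPoly d) :
    fischer (T + 1) f g = ((T : ℂ) + 1)⁻¹ * ∑ x, fischer T (pderiv x f) (pderiv x g) := rfl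

lemma fischer_add_left (T : ℕ) (f f' g : MatPoly d) :
    fischer T (f + f') g = fischer T f g + fischer T f' g := by
  induction T generalizing f f' g with
  | zero => simp [fischer, add_mul]
  | succ T ih => simp [fischer, ih, Finset.sum_add_distrib, mul_add]

lemma fischer_smul_left (T : ℕ) (c : ℂ) (f g : MatPoly d) :
    fischer T (c • f) g = c * fischer T f g := by
  induction T generalizing f g with
  | zero => simp [fischer, mul_assoc]
  | succ T ih =>
    simp only [fischer, Derivation.map_smul, ih, ← Finset.mul_sum]
    ring

lemma conj_fischer (T : ℕ) (f g : MatPoly d) : conj (fischer T f g) = fischer T g f := by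
  induction T generalizing f g with
  | zero => simp [fischer, mul_comm]
  | succ T ih => simp [fischer, ih]

lemma fischer_self_re_nonneg (T : ℕ) (f : MatPoly d) : 0 ≤ (fischer T f f).re := by
  induction T generalizing f with
  | zero => simp [fischer, Complex.mul_conj, Complex.normSq_nonneg]
  | succ T ih =>
    have : ((T : ℂ) + 1)⁻¹ = (((T : ℝ) + 1)⁻¹ : ℝ) := by push_cast; rfl
    rw [fischer, this, Complex.re_ofReal_mul, Complex.re_sum]
    exact mul_nonneg (by positivity) (Finset.sum_nonneg fun x _ => ih _)

lemma pderiv_pderiv_comm (x y : Fin d × Fin d) (f : MatPoly d) :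
    pderiv x (pderiv y f) = pderiv y (pderiv x f) := by
  have h : ⁅(pderiv x : Derivation ℂ (MatPoly d) (MatPoly d)),
      (pderiv y : Derivation ℂ (MatPoly d) (MatPoly d))⁆ = 0 := by
    refine derivation_ext fun z => ?_
    simp [Derivation.commutator_apply, pderiv_X, Pi.single_apply, apply_ite]
  have := congrArg (fun D => D f) h
  simpa [Derivation.commutator_apply, sub_eq_zero] using this

/-- Multiplication by a variable is adjoint to the corresponding partial derivative. The factor
(T+1)⁻¹ in `fischer` is chosen for this: by the Leibniz rule the sum over `x` produces T+1 copies of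
the right side in the step to degree T+1. -/
lemma fischer_X_mul (T : ℕ) (y : Fin d × Fin d) (f g : MatPoly d) :
    fischer (T + 1) (X y * f) g = fischer T f (pderiv y g) := by
  induction T generalizing f g with
  | zero =>
    rw [fischer_succ, Finset.sum_eq_single (a := y)]
    · simp [fischer, pderiv_X]
    · intro x _ hx
      simp [fischer, pderiv_X, hx.symm]
    · simp
  | succ T ih =>
    have h : ∀ x, fischer (T + 1) (pderiv x (X y * f)) (pderiv x g) =
        (if y = x then fischer (T + 1) f (pderiv x g) else 0) +
          fischer T (pderiv x f) (pderiv x (pderiv y g)) := by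
      intro x
      rw [Derivation.leibniz, smul_eq_mul, fischer_add_left, ih, pderiv_pderiv_comm y x, pderiv_X,
        add_comm]
      by_cases hxy : y = x
      · subst hxy; simp
      · have := fischer_smul_left (T + 1) 0 f (pderiv x g)
        simp_all [eq_comm]
    have h' : ∑ x, fischer T (pderiv x f) (pderiv x (pderiv y g)) =
        ((T : ℂ) + 1) * fischer (T + 1) f (pderiv y g) := by
      rw [fischer, mul_inv_cancel_left₀ (Nat.cast_add_one_ne_zero T)]
    rw [fischer]
    simp only [h, Finset.sum_add_distrib, h']
    simp only [Finset.sum_ite_eq, Finset.mem_univ, if_true]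
    have : ((T : ℂ) + 1 + 1) ≠ 0 := by exact_mod_cast Nat.succ_ne_zero (T + 1)
    push_cast
    field_simp
    ring

lemma fischer_sum_left {ι : Type*} (s : Finset ι) (T : ℕ) (f : ι → MatPoly d) (g : MatPoly d) :
    fischer T (∑ i ∈ s, f i) g = ∑ i ∈ s, fischer T (f i) g := by
  classical
  induction s using Finset.induction_on with
  | empty => simpa using fischer_smul_left T 0 0 g
  | insert a s ha ih => rw [Finset.sum_insert ha, Finset.sum_insert ha, fischer_add_left, ih]

lemma fischer_sum_right {ι : Type*} (s : Finset ι) (T : ℕ) (f : MatPoly d) (g : ι → MatPoly d) :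
    fischer T f (∑ i ∈ s, g i) = ∑ i ∈ s, fischer T f (g i) := by
  rw [← conj_fischer, fischer_sum_left, map_sum]
  simp only [conj_fischer]

lemma fischer_smul_right (T : ℕ) (c : ℂ) (f g : MatPoly d) :
    fischer T f (c • g) = conj c * fischer T f g := by
  rw [← conj_fischer, fischer_smul_left, map_mul, conj_fischer]

lemma fischer_add_right (T : ℕ) (f g g' : MatPoly d) :
    fischer T f (g + g') = fischer T f g + fischer T f g' := by
  rw [← conj_fischer, fischer_add_left, map_add, conj_fischer, conj_fischer]

/-- The directional derivative dual to multiplication by `linForm l`. -/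
noncomputable def dualDeriv (l : Fin d × Fin d → ℂ) (f : MatPoly d) : MatPoly d :=
  ∑ x, conj (l x) • pderiv x f

lemma fischer_linForm_mul (T : ℕ) (l : Fin d × Fin d → ℂ) (f g : MatPoly d) :
    fischer (T + 1) (linForm l * f) g = fischer T f (dualDeriv l g) := by
  simp only [linForm, dualDeriv, Finset.sum_mul, smul_mul_assoc, fischer_sum_left,
    fischer_sum_right, fischer_smul_left, fischer_smul_right, fischer_X_mul, Complex.conj_conj]

/-- The canonical commutation relation between the multiplication by a linear form and its adjoint.
-/
lemma dualDeriv_linForm_mul (l : Fin d × Fin d → ℂ) (f : MatPoly d) :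
    dualDeriv l (linForm l * f) =
      ((∑ x, ‖l x‖ ^ 2 : ℝ) : ℂ) • f + linForm l * dualDeriv l f := by
  have h : ∀ x, pderiv x (linForm l) = C (l x) := by
    intro x
    rw [linForm, map_sum, Finset.sum_eq_single x]
    · simp [pderiv_X, smul_eq_C_mul]
    · intro y _ hy
      simp [pderiv_X, hy]
    · simp
  simp only [dualDeriv, Derivation.leibniz, h, smul_add, Finset.sum_add_distrib, smul_eq_mul,
    Finset.mul_sum, mul_smul_comm]
  rw [add_comm]
  congr 1
  push_cast
  rw [Finset.sum_smul]
  refine Finset.sum_congr rfl fun x _ => ?_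
  rw [mul_comm f, ← smul_eq_C_mul, smul_smul, ← Complex.mul_conj', mul_comm]

/-- Multiplication by a linear form increases the Fischer norm. -/
lemma le_fischer_linForm_mul (T : ℕ) (l : Fin d × Fin d → ℂ) (f : MatPoly d) :
    (∑ x, ‖l x‖ ^ 2) * (fischer T f f).re ≤
      (fischer (T + 1) (linForm l * f) (linForm l * f)).re := by
  -- Commuting the adjoint past the multiplication leaves ‖l‖² times the norm of `f` plus a
  -- remainder, which is the squared norm of `dualDeriv l f`; in degree 0 it vanishes because linear
  -- forms vanish at 0.
  rw [fischer_linForm_mul, dualDeriv_linForm_mul, fischer_add_right, fischer_smul_right,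
    Complex.conj_ofReal, Complex.add_re, Complex.re_ofReal_mul, le_add_iff_nonneg_right,
    ← conj_fischer, Complex.conj_re]
  cases T with
  | zero =>
    simp [fischer, linForm]
  | succ T =>
    rw [fischer_linForm_mul]
    exact fischer_self_re_nonneg _ _

end MatPoly

/-! ### Integration of polynomials over the unitary group -/

instance haarUnitary_isHaarMeasure (d : ℕ) : (haarUnitary d).IsHaarMeasure := by
  unfold haarUnitary; infer_instance

instance haarUnitary_isMulRightInvariant (d : ℕ) : (haarUnitary d).IsMulRightInvariant where
  map_mul_right_eq_self g := by
    have : IsProbabilityMeasure ((haarUnitary d).map (· * g)) :=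
      Measure.isProbabilityMeasure_map (measurable_mul_const g).aemeasurable
    exact Measure.isHaarMeasure_eq_of_isProbabilityMeasure _ _

lemma integrable_haarUnitary {d : ℕ} {E : Type*} [NormedAddCommGroup E]
    {F : Matrix.unitaryGroup (Fin d) ℂ → E} (hF : Continuous F) :
    Integrable F (haarUnitary d) :=
  hF.integrable_of_hasCompactSupport (.of_compactSpace F)

namespace MatPoly

open MvPolynomial ComplexConjugate

variable {d : ℕ}

@[fun_prop]
lemma continuous_evalAt (f : MatPoly d) :
    Continuous fun U : Matrix.unitaryGroup (Fin d) ℂ => evalAt U f := by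
  refine (MvPolynomial.continuous_eval f).comp (continuous_pi fun x => ?_)
  exact continuous_subtype_val.matrix_elem _ _

/-! ### Infinitesimal right translations and their adjoints -/

lemma hasDerivAt_mul_exp_apply (U A : Matrix (Fin d) (Fin d) ℂ) (t : ℝ) (i j : Fin d) :
    HasDerivAt (fun t : ℝ => (U * NormedSpace.exp (t • A)) i j)
      ((U * NormedSpace.exp (t • A) * A) i j) t := by
  let : NormedRing (Matrix (Fin d) (Fin d) ℂ) := Matrix.linftyOpNormedRing
  let : NormedAlgebra ℝ (Matrix (Fin d) (Fin d) ℂ) := Matrix.linftyOpNormedAlgebra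
  have h := (hasDerivAt_exp_smul_const A t).const_mul U
  rw [← mul_assoc] at h
  exact ((Matrix.entryLinearMap ℝ ℂ i j).toContinuousLinearMap.hasFDerivAt
    (x := U * NormedSpace.exp (t • A))).comp_hasDerivAt t h

lemma exp_smul_mem_unitaryGroup {A : Matrix (Fin d) (Fin d) ℂ}
    (hA : A ∈ skewAdjoint (Matrix (Fin d) (Fin d) ℂ)) (t : ℝ) :
    NormedSpace.exp (t • A) ∈ Matrix.unitaryGroup (Fin d) ℂ := by
  have h : (t • A)ᴴ = -(t • A) := skewAdjoint.mem_iff.1 (skewAdjoint.smul_mem t hA)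
  rw [Matrix.mem_unitaryGroup_iff, Matrix.star_eq_conjTranspose, ← Matrix.exp_conjTranspose, h,
    ← Matrix.exp_add_of_commute _ _ (Commute.refl (t • A)).neg_right, add_neg_cancel,
    NormedSpace.exp_zero]

lemma hasDerivAt_evalAt_mul_exp (U A : Matrix (Fin d) (Fin d) ℂ) (f : MatPoly d) (t : ℝ) :
    HasDerivAt (fun t : ℝ => evalAt (U * NormedSpace.exp (t • A)) f)
      (evalAt (U * NormedSpace.exp (t • A)) (rightDeriv A f)) t := by
  induction f using MvPolynomial.induction_on with
  | C c => simpa [rightDeriv] using hasDerivAt_const t c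
  | add f g hf hg =>
    simp only [map_add]
    exact hf.add hg
  | mul_X f x hf =>
    have h := hf.mul (hasDerivAt_mul_exp_apply U A t x.1 x.2)
    have h' : evalAt (U * NormedSpace.exp (t • A)) (rightDeriv A (X x)) =
        (U * NormedSpace.exp (t • A) * A) x.1 x.2 := by
      rw [Matrix.mul_apply]
      simp [rightDeriv_X, mul_comm]
    simp only [map_mul, evalAt_X, Derivation.leibniz, map_add, smul_eq_mul, h']
    convert! h using 1
    ring

/-- The `L²` inner product of polynomials on the unitary group. -/
noncomputable def haarInner (f g : MatPoly d) : ℂ :=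
  ∫ U, evalAt (U : Matrix (Fin d) (Fin d) ℂ) f * conj (evalAt U g) ∂(haarUnitary d)

/-- The square of the `L²` norm of a polynomial on the unitary group. -/
noncomputable def haarNormSq (f : MatPoly d) : ℝ :=
  ∫ U, ‖evalAt (U : Matrix (Fin d) (Fin d) ℂ) f‖ ^ 2 ∂(haarUnitary d)

lemma integrable_mul_conj (f g : MatPoly d) :
    Integrable (fun U : Matrix.unitaryGroup (Fin d) ℂ => evalAt U f * conj (evalAt U g))
      (haarUnitary d) :=
  integrable_haarUnitary (by fun_prop)

lemma integrable_norm_sq (f : MatPoly d) :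
    Integrable (fun U : Matrix.unitaryGroup (Fin d) ℂ => ‖evalAt U f‖ ^ 2) (haarUnitary d) :=
  integrable_haarUnitary (by fun_prop)

lemma haarInner_add_left (f f' g : MatPoly d) :
    haarInner (f + f') g = haarInner f g + haarInner f' g := by
  simp only [haarInner, map_add, add_mul]
  exact integral_add (integrable_mul_conj _ _) (integrable_mul_conj _ _)

lemma haarInner_smul_left (c : ℂ) (f g : MatPoly d) :
    haarInner (c • f) g = c * haarInner f g := by
  simp only [haarInner, evalAt_smul, mul_assoc]
  exact integral_const_mul _ _

lemma conj_haarInner (f g : MatPoly d) : conj (haarInner f g) = haarInner g f := by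
  simp only [haarInner, ← integral_conj, map_mul, Complex.conj_conj, mul_comm]

lemma haarInner_add_right (f g g' : MatPoly d) :
    haarInner f (g + g') = haarInner f g + haarInner f g' := by
  rw [← conj_haarInner, haarInner_add_left, map_add, conj_haarInner, conj_haarInner]

lemma haarInner_smul_right (c : ℂ) (f g : MatPoly d) :
    haarInner f (c • g) = conj c * haarInner f g := by
  rw [← conj_haarInner, haarInner_smul_left, map_mul, conj_haarInner]

lemma haarInner_sum_left {ι : Type*} (s : Finset ι) (f : ι → MatPoly d) (g : MatPoly d) :
    haarInner (∑ i ∈ s, f i) g = ∑ i ∈ s, haarInner (f i) g := by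
  classical
  induction s using Finset.induction_on with
  | empty => simpa using haarInner_smul_left 0 0 g
  | insert a s ha ih => rw [Finset.sum_insert ha, Finset.sum_insert ha, haarInner_add_left, ih]

lemma haarInner_sum_right {ι : Type*} (s : Finset ι) (f : MatPoly d) (g : ι → MatPoly d) :
    haarInner f (∑ i ∈ s, g i) = ∑ i ∈ s, haarInner f (g i) := by
  rw [← conj_haarInner, haarInner_sum_left, map_sum]
  simp only [conj_haarInner]

lemma haarInner_self (f : MatPoly d) : haarInner f f = haarNormSq f := by
  simp only [haarInner, haarNormSq, Complex.mul_conj', ← Complex.ofReal_pow]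
  exact integral_ofReal

lemma norm_evalAt_le_of_unitary {T : ℕ} {r : ℝ} {f : MatPoly d} (h : MonomialBound T r f)
    (U : Matrix.unitaryGroup (Fin d) ℂ) : ‖evalAt (U : Matrix (Fin d) (Fin d) ℂ) f‖ ≤ r :=
  h.norm_evalAt_le (entry_norm_bound_of_unitary U.2)

/-- The derivation attached to a skew-adjoint matrix is skew-adjoint. -/
lemma haarInner_rightDeriv_of_skewAdjoint {A : Matrix (Fin d) (Fin d) ℂ}
    (hA : A ∈ skewAdjoint (Matrix (Fin d) (Fin d) ℂ)) (f g : MatPoly d) :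
    haarInner (rightDeriv A f) g + haarInner f (rightDeriv A g) = 0 := by
  set V : ℝ → Matrix.unitaryGroup (Fin d) ℂ := fun t =>
    ⟨NormedSpace.exp (t • A), exp_smul_mem_unitaryGroup hA t⟩ with hV
  set F : Matrix.unitaryGroup (Fin d) ℂ → ℂ := fun U => evalAt U f * conj (evalAt U g) with hF
  set F' : Matrix.unitaryGroup (Fin d) ℂ → ℂ := fun U =>
    evalAt U (rightDeriv A f) * conj (evalAt U g) +
      evalAt U f * conj (evalAt U (rightDeriv A g)) with hF'
  have hFc : Continuous F := by fun_prop
  have hF'c : Continuous F' := by fun_prop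
  have hdiff : ∀ U t, HasDerivAt (fun t => F (U * V t)) (F' (U * V t)) t := by
    intro U t
    have hf := hasDerivAt_evalAt_mul_exp U A f t
    have hg := (hasDerivAt_evalAt_mul_exp U A g t).star
    exact hf.mul hg
  obtain ⟨M, hM⟩ := (isCompact_range hF'c).isBounded.exists_norm_le
  have key := (hasDerivAt_integral_of_dominated_loc_of_deriv_le (μ := haarUnitary d)
    (F := fun t U => F (U * V t)) (F' := fun t U => F' (U * V t)) (x₀ := (0 : ℝ))
    (s := Set.univ) (bound := fun _ => M) Filter.univ_mem
    (.of_forall fun t => (hFc.comp (continuous_mul_const _)).aestronglyMeasurable)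
    (integrable_haarUnitary (hFc.comp (continuous_mul_const _)))
    (hF'c.comp (continuous_mul_const _)).aestronglyMeasurable
    (.of_forall fun U t _ => hM _ ⟨_, rfl⟩) (integrable_const _)
    (.of_forall fun U t _ => hdiff U t)).2
  -- Right invariance makes the integral of `F (U * V t)` constant in `t`, so its derivative, the
  -- integral of `F'`, is zero.
  simp only [integral_mul_right_eq_self F, integral_mul_right_eq_self F'] at key
  have h0 := key.unique (hasDerivAt_const _ _)
  rw [hF', integral_add (integrable_mul_conj _ _) (integrable_mul_conj _ _)] at h0
  exact h0

/-- The matrices e_{ij} - e_{ji} and i(e_{ij} + e_{ji}) are skew-adjoint and span e_{ij} over ℂ.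
Complex linearity turns skewness for these two into the adjoint relation. -/
lemma haarInner_unitDeriv (i j : Fin d) (f g : MatPoly d) :
    haarInner (unitDeriv i j f) g = haarInner f (unitDeriv j i g) := by
  have hA : Matrix.single i j (1 : ℂ) + (-1 : ℂ) • Matrix.single j i 1 ∈
      skewAdjoint (Matrix (Fin d) (Fin d) ℂ) := by
    rw [skewAdjoint.mem_iff]
    simp [Matrix.star_eq_conjTranspose, Matrix.conjTranspose_single]
  have hB : Complex.I • (Matrix.single i j (1 : ℂ) + Matrix.single j i 1) ∈
      skewAdjoint (Matrix (Fin d) (Fin d) ℂ) := by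
    rw [skewAdjoint.mem_iff]
    simp [Matrix.star_eq_conjTranspose, Matrix.single_neg, add_comm]
  have h1 := haarInner_rightDeriv_of_skewAdjoint hA f g
  have h2 := haarInner_rightDeriv_of_skewAdjoint hB f g
  simp only [rightDeriv_add, rightDeriv_smul, Derivation.add_apply, Derivation.smul_apply,
    haarInner_add_left, haarInner_add_right, haarInner_smul_left, haarInner_smul_right,
    Complex.conj_I, map_neg, map_one] at h1 h2
  change haarInner (rightDeriv _ f) g = haarInner f (rightDeriv _ g)
  linear_combination h1 / 2 - Complex.I / 2 * h2 - (1 / 2 : ℂ) * Complex.I_mul_I *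
    (haarInner (rightDeriv (Matrix.single i j 1) f) g +
      haarInner (rightDeriv (Matrix.single j i 1) f) g -
      haarInner f (rightDeriv (Matrix.single i j 1) g) -
      haarInner f (rightDeriv (Matrix.single j i 1) g)) * (-1)

lemma haarInner_casimir (f g : MatPoly d) : haarInner (casimir f) g = haarInner f (casimir g) := by
  simp only [casimir_apply, haarInner_sum_left, haarInner_sum_right, haarInner_unitDeriv]

/-! ### From coefficient bounds to the gradient estimate -/

lemma two_mul_re_haarInner_le (f g : MatPoly d) {s : ℝ} (hs : 0 < s) :
    2 * (haarInner f g).re ≤ s * haarNormSq f + s⁻¹ * haarNormSq g := by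
  have h : ∀ a b : ℂ, 2 * (a * conj b).re ≤ s * ‖a‖ ^ 2 + s⁻¹ * ‖b‖ ^ 2 := by
    intro a b
    have h1 : (a * conj b).re ≤ ‖a‖ * ‖b‖ :=
      (Complex.re_le_norm _).trans_eq (by rw [norm_mul, Complex.norm_conj])
    have h2 : s * ‖a‖ ^ 2 + s⁻¹ * ‖b‖ ^ 2 - 2 * (‖a‖ * ‖b‖) = s⁻¹ * (s * ‖a‖ - ‖b‖) ^ 2 := by
      field_simp
      ring
    have h3 : 0 ≤ s⁻¹ * (s * ‖a‖ - ‖b‖) ^ 2 := by positivity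
    linarith
  have hre : (haarInner f g).re = ∫ U, (evalAt (U : Matrix (Fin d) (Fin d) ℂ) f *
      conj (evalAt U g)).re ∂(haarUnitary d) :=
    (integral_re (integrable_mul_conj f g)).symm
  rw [hre, haarNormSq, haarNormSq, ← integral_const_mul, ← integral_const_mul,
    ← integral_const_mul, ← integral_add ((integrable_norm_sq f).const_mul _)
    ((integrable_norm_sq g).const_mul _)]
  exact integral_mono ((integrable_mul_conj f g).re.const_mul _)
    (((integrable_norm_sq f).const_mul _).add ((integrable_norm_sq g).const_mul _))
    fun U => h _ _

/-- A bounded convex sequence does not increase at its start. -/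
lemma _root_.apply_one_le_apply_zero_of_convex_of_bounded {β : ℕ → ℝ} {K : ℝ}
    (h : ∀ n, 2 * β (n + 1) ≤ β n + β (n + 2)) (hK : ∀ n, β n ≤ K) : β 1 ≤ β 0 := by
  by_contra! hlt
  have h1 : ∀ n, β 1 - β 0 ≤ β (n + 1) - β n := by
    intro n
    induction n with
    | zero => simp
    | succ n ih => linarith [h n]
  have h2 : ∀ n : ℕ, β 0 + n * (β 1 - β 0) ≤ β n := by
    intro n
    induction n with
    | zero => simp
    | succ n ih => push_cast; linarith [h1 n]
  obtain ⟨n, hn⟩ := exists_nat_gt ((K - β 0) / (β 1 - β 0))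
  rw [div_lt_iff₀ (sub_pos.2 hlt)] at hn
  linarith [h2 n, hK n]

/-- Power trick: the squared norms of the iterates, scaled by N^(2n), form a convex sequence by
symmetry and are bounded by r². Hence the first step cannot increase, and `r` disappears from the
conclusion. -/
lemma re_haarInner_casimir_le {T : ℕ} {r : ℝ} {f : MatPoly d} (h : MonomialBound T r f) :
    (haarInner (casimir f) f).re ≤ T * (d + T - 1) * haarNormSq f := by
  set N : ℝ := T * (d + T - 1) with hN
  have hN0 : 0 ≤ N := by
    rcases T with _ | T
    · simp [hN]
    · have : (0 : ℝ) ≤ d := d.cast_nonneg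
      push_cast at hN
      rw [hN]
      exact mul_nonneg (by positivity) (by linarith [T.cast_nonneg (α := ℝ)])
  rcases hN0.eq_or_lt with hN0 | hN0
  -- The scaling by powers of `N` fails for `N` = 0, but then the coefficient bound already makes
  -- `casimir f` vanish on the unitary group.
  · have h0 : ∀ U : Matrix.unitaryGroup (Fin d) ℂ, evalAt U (casimir f) = 0 := by
      intro U
      have := norm_evalAt_le_of_unitary h.casimir U
      rw [← hN, ← hN0, zero_mul] at this
      exact norm_le_zero_iff.1 this
    simp [haarInner, h0, ← hN0]
  have hconv := apply_one_le_apply_zero_of_convex_of_bounded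
    (β := fun n => haarNormSq (casimir^[n] f) / N ^ (2 * n)) (K := r ^ 2) ?_ ?_
  · have h1 : haarNormSq (casimir f) ≤ N ^ 2 * haarNormSq f := by
      have : haarNormSq (casimir f) / N ^ 2 ≤ haarNormSq f := by simpa using hconv
      rwa [div_le_iff₀' (by positivity)] at this
    have h2 := two_mul_re_haarInner_le (casimir f) f (inv_pos.2 hN0)
    have h3 : N⁻¹ * haarNormSq (casimir f) ≤ N * haarNormSq f := by
      rw [inv_mul_le_iff₀ hN0]
      linarith
    rw [inv_inv] at h2
    linarith
  · intro n
    have h1 : haarNormSq (casimir^[n + 1] f) =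
        (haarInner (casimir^[n] f) (casimir^[n + 2] f)).re := by
      rw [Function.iterate_succ_apply' casimir (n + 1), ← haarInner_casimir,
        ← Function.iterate_succ_apply' casimir, haarInner_self, Complex.ofReal_re]
    have h2 := two_mul_re_haarInner_le (casimir^[n] f) (casimir^[n + 2] f)
      (show 0 < N ^ 2 by positivity)
    rw [← h1] at h2
    have h3 : N ^ (2 * (n + 1)) = N ^ (2 * n) * N ^ 2 := by ring
    have h4 : N ^ (2 * (n + 2)) = N ^ (2 * n) * N ^ 2 * N ^ 2 := by ring
    rw [h3, h4]
    calc 2 * (haarNormSq (casimir^[n + 1] f) / (N ^ (2 * n) * N ^ 2))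
        = 2 * haarNormSq (casimir^[n + 1] f) / (N ^ (2 * n) * N ^ 2) := by ring
      _ ≤ (N ^ 2 * haarNormSq (casimir^[n] f) + (N ^ 2)⁻¹ * haarNormSq (casimir^[n + 2] f)) /
          (N ^ (2 * n) * N ^ 2) := by gcongr
      _ = _ := by field_simp
  · intro n
    rw [div_le_iff₀ (by positivity)]
    have h1 : ∀ U : Matrix.unitaryGroup (Fin d) ℂ,
        ‖evalAt (U : Matrix (Fin d) (Fin d) ℂ) (casimir^[n] f)‖ ^ 2 ≤ (N ^ n * r) ^ 2 := fun U =>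
      pow_le_pow_left₀ (norm_nonneg _) (norm_evalAt_le_of_unitary (h.casimir_iterate n) U) 2
    calc haarNormSq (casimir^[n] f) ≤ ∫ _, (N ^ n * r) ^ 2 ∂(haarUnitary d) :=
          integral_mono (integrable_norm_sq _) (integrable_const _) h1
      _ = r ^ 2 * N ^ (2 * n) := by
          rw [integral_const, probReal_univ, one_smul]
          ring

/-- At a unitary the matrix of the `unitDeriv i j f` is Uᵀ times the matrix of partial derivatives,
and Uᵀ preserves the Frobenius norm. -/
lemma sum_norm_sq_unitDeriv (U : Matrix.unitaryGroup (Fin d) ℂ) (f : MatPoly d) :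
    ∑ i, ∑ j, ‖evalAt (U : Matrix (Fin d) (Fin d) ℂ) (unitDeriv i j f)‖ ^ 2 =
      ∑ x, ‖evalAt (U : Matrix (Fin d) (Fin d) ℂ) (pderiv x f)‖ ^ 2 := by
  set P : Matrix (Fin d) (Fin d) ℂ := Matrix.of fun i j =>
    evalAt (U : Matrix (Fin d) (Fin d) ℂ) (pderiv (i, j) f) with hP
  have hfro : ∀ Q : Matrix (Fin d) (Fin d) ℂ,
      ((∑ i, ∑ j, ‖Q i j‖ ^ 2 : ℝ) : ℂ) = (Qᴴ * Q).trace := by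
    intro Q
    rw [Finset.sum_comm]
    simp [Matrix.trace, Matrix.mul_apply, Complex.conj_mul']
  have h1 : ∀ i j, evalAt (U : Matrix (Fin d) (Fin d) ℂ) (unitDeriv i j f) =
      ((U : Matrix (Fin d) (Fin d) ℂ)ᵀ * P) i j := by
    intro i j
    simp [unitDeriv_eq_sum, Matrix.mul_apply, hP]
  have h2 : ((U : Matrix (Fin d) (Fin d) ℂ)ᵀ)ᴴ * (U : Matrix (Fin d) (Fin d) ℂ)ᵀ = 1 := by
    have := congrArg Matrix.transpose (Matrix.mem_unitaryGroup_iff.1 U.2)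
    rw [Matrix.transpose_mul, Matrix.transpose_one] at this
    exact this
  rw [Fintype.sum_prod_type]
  simp only [h1]
  apply Complex.ofReal_injective
  rw [hfro, Matrix.conjTranspose_mul, Matrix.mul_assoc, ← Matrix.mul_assoc _ _ P, h2,
    Matrix.one_mul, ← hfro]
  rfl

/-- The `L²` norm of the gradient of a homogeneous polynomial on the unitary group. -/
lemma sum_haarNormSq_pderiv_le {T : ℕ} {r : ℝ} {f : MatPoly d} (h : MonomialBound T r f) :
    ∑ x, haarNormSq (pderiv x f) ≤ T * (d + T - 1) * haarNormSq f := by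
  refine le_trans (le_of_eq ?_) (re_haarInner_casimir_le h)
  have h1 : (haarInner (casimir f) f).re = ∑ i, ∑ j, haarNormSq (unitDeriv i j f) := by
    simp only [casimir_apply, haarInner_sum_left, haarInner_unitDeriv, haarInner_self,
      ← Complex.ofReal_sum, Complex.ofReal_re]
  rw [h1]
  simp only [haarNormSq]
  rw [← integral_finsetSum _ fun x _ => integrable_norm_sq _]
  simp only [← sum_norm_sq_unitDeriv]
  rw [integral_finsetSum _ fun i _ => integrable_finsetSum _ fun j _ => integrable_norm_sq _]
  exact Finset.sum_congr rfl fun i _ => integral_finsetSum _ fun j _ => integrable_norm_sq _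

/-- In the step to degree T+1 the gradient estimate costs (T+1)(d+T); the normalization of `fischer`
cancels T+1 and leaves the new factor d+T. -/
lemma fischer_self_le {T : ℕ} {r : ℝ} {f : MatPoly d} (h : MonomialBound T r f) :
    (fischer T f f).re ≤ (∏ i ∈ Finset.range T, ((d : ℝ) + i)) * haarNormSq f := by
  induction T generalizing r f with
  | zero =>
    obtain ⟨c, rfl⟩ := h.exists_eq_C
    simp [fischer, haarNormSq, Complex.mul_conj', ← Complex.ofReal_pow]
  | succ T ih =>
    have hinv : ((T : ℂ) + 1)⁻¹ = (((T : ℝ) + 1)⁻¹ : ℝ) := by push_cast; rfl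
    have hprod : 0 ≤ ∏ i ∈ Finset.range T, ((d : ℝ) + i) :=
      Finset.prod_nonneg fun i _ => by positivity
    rw [fischer_succ, hinv, Complex.re_ofReal_mul, Complex.re_sum, inv_mul_le_iff₀ (by positivity),
      Finset.prod_range_succ]
    calc ∑ x, (fischer T (pderiv x f) (pderiv x f)).re
        ≤ ∑ x, (∏ i ∈ Finset.range T, ((d : ℝ) + i)) * haarNormSq (pderiv x f) := by
          refine Finset.sum_le_sum fun x _ => ?_
          obtain ⟨s, hs⟩ := h.exists_pderiv x T rfl
          exact ih hs
      _ ≤ (∏ i ∈ Finset.range T, ((d : ℝ) + i)) *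
          ((T + 1 : ℕ) * (d + (T + 1 : ℕ) - 1) * haarNormSq f) := by
          rw [← Finset.mul_sum]
          exact mul_le_mul_of_nonneg_left (sum_haarNormSq_pderiv_le h) hprod
      _ = _ := by push_cast; ring

end MatPoly

/-! ### Outcome probabilities -/

lemma SuperOp.extend_unitaryChannel_apply {d d' : ℕ} (U : Matrix.unitaryGroup (Fin d) ℂ)
    (X : Matrix (Fin d × Fin d') (Fin d × Fin d') ℂ) :
    (unitaryChannel U).extend d' X =
      ((U : Matrix (Fin d) (Fin d) ℂ) ⊗ₖ (1 : Matrix (Fin d') (Fin d') ℂ)) * X *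
        ((U : Matrix (Fin d) (Fin d) ℂ) ⊗ₖ (1 : Matrix (Fin d') (Fin d') ℂ))ᴴ := by
  ext ⟨a, i⟩ ⟨b, j⟩
  simp [SuperOp.extend, unitaryChannel, Matrix.mul_apply, Fintype.sum_prod_type,
    Matrix.one_apply, Finset.sum_mul, apply_ite]

lemma SuperOp.extend_depolarizing_apply {d d' : ℕ}
    (X : Matrix (Fin d × Fin d') (Fin d × Fin d') ℂ) (a b : Fin d) (i j : Fin d') :
    (depolarizing d).extend d' X (a, i) (b, j) =
      if a = b then (∑ c, X (c, i) (c, j)) / d else 0 := by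
  simp [SuperOp.extend, depolarizing, Matrix.trace, Matrix.one_apply]

open scoped MatrixOrder in
lemma Matrix.PosSemidef.exists_eq_conjTranspose_mul_self {n : Type*} [Fintype n] [DecidableEq n]
    {M : Matrix n n ℂ} (hM : M.PosSemidef) : ∃ B : Matrix n n ℂ, M = Bᴴ * B :=
  CStarAlgebra.nonneg_iff_eq_star_mul_self.1 hM.nonneg

/-- With `F = Bᴴ B` and `ρ = A Aᴴ`, the outcome probabilities of both kinds of channels are given
by the linear forms `U ↦ (B (U ⊗ 1) A)_{pq}`. -/
lemma exists_linear_forms {d d' : ℕ} {F ρ : Matrix (Fin d × Fin d') (Fin d × Fin d') ℂ}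
    (hF : F.PosSemidef) (hρ : ρ.PosSemidef) :
    ∃ l : (Fin d × Fin d') × (Fin d × Fin d') → Fin d × Fin d → ℂ,
      (∀ U : Matrix.unitaryGroup (Fin d) ℂ, (F * (unitaryChannel U).extend d' ρ).trace.re =
        ∑ y, ‖∑ x, l y x * (U : Matrix (Fin d) (Fin d) ℂ) x.1 x.2‖ ^ 2) ∧
      d * (F * (depolarizing d).extend d' ρ).trace.re = ∑ y, ∑ x, ‖l y x‖ ^ 2 := by
  obtain ⟨B, rfl⟩ := hF.exists_eq_conjTranspose_mul_self
  obtain ⟨A, rfl⟩ : ∃ A, ρ = A * Aᴴ := by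
    obtain ⟨A, hA⟩ := hρ.exists_eq_conjTranspose_mul_self
    exact ⟨Aᴴ, by simpa using hA⟩
  -- The coefficient at (a, c) is the entry `y` of B (e_{ac} ⊗ 1) A. The operators e_{ac}/√d are
  -- Kraus operators of the depolarizing channel, which explains the second identity.
  refine ⟨fun y x => ∑ i, B y.1 (x.1, i) * A (x.2, i) y.2, fun U => ?_, ?_⟩
  · set W := (U : Matrix (Fin d) (Fin d) ℂ) ⊗ₖ (1 : Matrix (Fin d') (Fin d') ℂ) with hW
    have h1 : (Bᴴ * B * (W * (A * Aᴴ) * Wᴴ)).trace = ((B * W * A) * (B * W * A)ᴴ).trace := by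
      rw [Matrix.mul_assoc, Matrix.trace_mul_comm]
      simp only [Matrix.conjTranspose_mul, Matrix.mul_assoc]
    have h2 : ∀ p q, (B * W * A) p q =
        ∑ x : Fin d × Fin d, (∑ i, B p (x.1, i) * A (x.2, i) q) *
          (U : Matrix (Fin d) (Fin d) ℂ) x.1 x.2 := by
      intro p q
      simp only [Matrix.mul_apply, hW, Matrix.kroneckerMap_apply, Fintype.sum_prod_type,
        Matrix.one_apply, Finset.sum_mul, mul_ite, mul_one, mul_zero, Finset.sum_ite_eq',
        Finset.mem_univ, if_true]
      refine Eq.trans (Finset.sum_congr rfl fun b _ => ?_) Finset.sum_comm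
      rw [Finset.sum_comm]
      exact Finset.sum_congr rfl fun a _ => Finset.sum_congr rfl fun i _ => by ring
    rw [SuperOp.extend_unitaryChannel_apply, ← hW, h1, Fintype.sum_prod_type]
    simp only [← h2, Matrix.trace, Matrix.diag, Matrix.mul_apply (M := B * W * A),
      Matrix.conjTranspose_apply]
    rw [Complex.re_sum]
    refine Finset.sum_congr rfl fun p _ => ?_
    rw [Complex.re_sum]
    refine Finset.sum_congr rfl fun q _ => ?_
    rw [Complex.star_def, Complex.mul_conj', ← Complex.ofReal_pow, Complex.ofReal_re]
  · set M := Bᴴ * B with hM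
    set R := A * Aᴴ with hR
    have h1 : ∀ a c, ((∑ p, ∑ q, ‖∑ i, B p (a, i) * A (c, i) q‖ ^ 2 : ℝ) : ℂ) =
        ∑ i, ∑ j, M (a, i) (a, j) * R (c, j) (c, i) := by
      intro a c
      set Ba : Matrix (Fin d × Fin d') (Fin d') ℂ := Matrix.of fun p i => B p (a, i) with hBa
      set Ac : Matrix (Fin d') (Fin d × Fin d') ℂ := Matrix.of fun i q => A (c, i) q with hAc
      have h2 : ((∑ p, ∑ q, ‖(Ba * Ac) p q‖ ^ 2 : ℝ) : ℂ) = (Ba * Ac * (Ba * Ac)ᴴ).trace := by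
        simp only [Matrix.trace, Matrix.diag, Matrix.mul_apply (M := Ba * Ac),
          Matrix.conjTranspose_apply, Complex.star_def, Complex.mul_conj', Complex.ofReal_sum,
          Complex.ofReal_pow]
      have h3 : (Ba * Ac * (Ba * Ac)ᴴ).trace = ((Baᴴ * Ba) * (Ac * Acᴴ)).trace := by
        rw [Matrix.mul_assoc Baᴴ, Matrix.trace_mul_comm Baᴴ]
        simp only [Matrix.conjTranspose_mul, Matrix.mul_assoc]
      rw [h3] at h2
      exact h2
    have h2 : (d : ℂ) * (M * (depolarizing d).extend d' R).trace =
        ∑ a, ∑ c, ∑ i, ∑ j, M (a, i) (a, j) * R (c, j) (c, i) := by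
      have hb : ∀ a i, (M * (depolarizing d).extend d' R) (a, i) (a, i) =
          ∑ j, M (a, i) (a, j) * ((∑ c, R (c, j) (c, i)) / d) := by
        intro a i
        rw [Matrix.mul_apply, Fintype.sum_prod_type, Finset.sum_eq_single a]
        · simp only [SuperOp.extend_depolarizing_apply, if_true]
        · intro b _ hb
          simp [SuperOp.extend_depolarizing_apply, hb]
        · simp
      simp only [Matrix.trace, Matrix.diag, Fintype.sum_prod_type, hb, Finset.mul_sum]
      refine Finset.sum_congr rfl fun a _ => ?_
      have hd : (d : ℂ) ≠ 0 := Nat.cast_ne_zero.2 (Fin.pos a).ne'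
      rw [Finset.sum_comm (s := Finset.univ (α := Fin d))]
      refine Finset.sum_congr rfl fun i _ => ?_
      rw [Finset.sum_comm (s := Finset.univ (α := Fin d))]
      refine Finset.sum_congr rfl fun j _ => ?_
      rw [← Finset.mul_sum]
      field_simp
    rw [← Complex.re_ofReal_mul, Complex.ofReal_natCast, h2]
    simp only [← h1, ← Complex.ofReal_sum, Complex.ofReal_re]
    refine Eq.trans ?_ Finset.sum_comm
    rw [Fintype.sum_prod_type]
    exact Finset.sum_congr rfl fun a _ => Finset.sum_congr rfl fun c _ =>
      (Fintype.sum_prod_type fun y : (Fin d × Fin d') × (Fin d × Fin d') =>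
        ‖∑ i, B y.1 (a, i) * A (c, i) y.2‖ ^ 2).symm

/-! ### Likelihood ratios along the tree -/

namespace LearningTree

variable {d d' : ℕ}

open MatPoly

lemma continuous_leafProb {T : ℕ} (t : LearningTree d d' T) (l : t.Leaf) :
    Continuous fun U : Matrix.unitaryGroup (Fin d) ℂ => t.leafProb (unitaryChannel U) l := by
  induction t with
  | leaf => exact continuous_const
  | node ρ F child ih =>
    obtain ⟨p, hU, -⟩ := exists_linear_forms (F.posSemidef l.1) ρ.posSemidef
    have h : Continuous fun U : Matrix.unitaryGroup (Fin d) ℂ =>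
        (F.effect l.1 * (unitaryChannel U).extend d' ρ.mat).trace.re := by
      simp only [hU, ← evalAt_linForm]
      fun_prop
    exact h.mul (ih l.1 l.2)

lemma leafProb_depolarizing_nonneg {T : ℕ} (t : LearningTree d d' T) (l : t.Leaf) :
    0 ≤ t.leafProb (depolarizing d) l := by
  induction t with
  | leaf => exact zero_le_one
  | node ρ F child ih =>
    refine mul_nonneg ?_ (ih l.1 l.2)
    obtain ⟨p, -, hD⟩ := exists_linear_forms (F.posSemidef l.1) ρ.posSemidef
    rcases d.eq_zero_or_pos with rfl | hd
    · simp [Matrix.trace]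
    · refine nonneg_of_mul_nonneg_right (hD ▸ ?_) (Nat.cast_pos.2 hd : (0 : ℝ) < d)
      positivity

/-- If `E ⊗ I` preserves traces, the leaf probabilities add up to one. -/
lemma sum_leafProb {E : SuperOp d} (hE : ∀ X, (E.extend d' X).trace = X.trace) {T : ℕ}
    (t : LearningTree d d' T) : ∑ l, t.leafProb E l = 1 := by
  induction t with
  | leaf => exact Fintype.sum_unique (ι := Unit) _
  | @node T m ρ F child ih =>
    have h1 : ∑ l, (node ρ F child).leafProb E l = ∑ v, ∑ l,
        (F.effect v * E.extend d' ρ.mat).trace.re * (child v).leafProb E l :=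
      Fintype.sum_sigma (α := fun v => (child v).Leaf) _
    rw [h1]
    simp only [← Finset.mul_sum, ih, mul_one]
    rw [← Complex.re_sum, ← Matrix.trace_sum, ← Matrix.sum_mul, F.sum_eq_one, Matrix.one_mul, hE,
      ρ.trace_eq_one, Complex.one_re]

lemma trace_extend_unitaryChannel (U : Matrix.unitaryGroup (Fin d) ℂ)
    (X : Matrix (Fin d × Fin d') (Fin d × Fin d') ℂ) :
    ((unitaryChannel U).extend d' X).trace = X.trace := by
  rw [SuperOp.extend_unitaryChannel_apply, Matrix.trace_mul_comm, ← Matrix.mul_assoc,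
    Matrix.conjTranspose_kronecker, ← Matrix.mul_kronecker_mul]
  have : (U : Matrix (Fin d) (Fin d) ℂ)ᴴ * U = 1 := Matrix.mem_unitaryGroup_iff'.1 U.2
  simp [this]

lemma trace_extend_depolarizing (X : Matrix (Fin d × Fin d') (Fin d × Fin d') ℂ) :
    ((depolarizing d).extend d' X).trace = X.trace := by
  rcases d.eq_zero_or_pos with rfl | hd
  · simp [Matrix.trace]
  have hd' : (d : ℂ) ≠ 0 := Nat.cast_ne_zero.2 hd.ne'
  simp only [Matrix.trace, Matrix.diag, Fintype.sum_prod_type, SuperOp.extend_depolarizing_apply,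
    if_true, ← Finset.sum_div]
  rw [Finset.sum_const, Finset.card_univ, Fintype.card_fin, nsmul_eq_mul, mul_div_cancel_left₀ _ hd']
  exact Finset.sum_comm

/-- Comparison of the likelihoods at a leaf, weighted by a homogeneous polynomial. -/
lemma le_integral_mul_leafProb {T : ℕ} (t : LearningTree d d' T) (l : t.Leaf) {k : ℕ} {r : ℝ}
    {g : MatPoly d} (hg : MonomialBound k r g) :
    d ^ T * t.leafProb (depolarizing d) l * (fischer k g g).re ≤
      (∏ i ∈ Finset.range (k + T), ((d : ℝ) + i)) *
        ∫ U, ‖evalAt (U : Matrix (Fin d) (Fin d) ℂ) g‖ ^ 2 * t.leafProb (unitaryChannel U) l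
          ∂(haarUnitary d) := by
  -- The polynomial `g` collects the linear forms of the rounds already passed; each node multiplies
  -- it by one more. At the end of the path what remains is the comparison of Fischer and Haar
  -- norms.
  induction t generalizing k r g with
  | leaf => simpa [leafProb, haarNormSq] using fischer_self_le hg
  | @node T m ρ F child ih =>
    obtain ⟨v, l⟩ := l
    obtain ⟨p, hU, hD⟩ := exists_linear_forms (F.posSemidef v) ρ.posSemidef
    have hpt : ∀ U : Matrix.unitaryGroup (Fin d) ℂ,
        ‖evalAt (U : Matrix (Fin d) (Fin d) ℂ) g‖ ^ 2 *
          (node ρ F child).leafProb (unitaryChannel U) ⟨v, l⟩ =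
        ∑ y, ‖evalAt (U : Matrix (Fin d) (Fin d) ℂ) (linForm (p y) * g)‖ ^ 2 *
          (child v).leafProb (unitaryChannel U) l := by
      intro U
      change _ * ((F.effect v * (unitaryChannel U).extend d' ρ.mat).trace.re * _) = _
      rw [hU, Finset.sum_mul, Finset.mul_sum]
      refine Finset.sum_congr rfl fun y _ => ?_
      rw [map_mul, norm_mul, evalAt_linForm]
      ring
    have hint : ∀ y ∈ Finset.univ, Integrable (fun U : Matrix.unitaryGroup (Fin d) ℂ =>
        ‖evalAt (U : Matrix (Fin d) (Fin d) ℂ) (linForm (p y) * g)‖ ^ 2 *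
          (child v).leafProb (unitaryChannel U) l) (haarUnitary d) := fun y _ =>
      integrable_haarUnitary (((continuous_evalAt _).norm.pow 2).mul (continuous_leafProb _ _))
    simp only [hpt]
    rw [integral_finsetSum _ hint, Finset.mul_sum, show k + (T + 1) = k + 1 + T by ring]
    have hq := leafProb_depolarizing_nonneg (child v) l
    calc (d : ℝ) ^ (T + 1) * (node ρ F child).leafProb (depolarizing d) ⟨v, l⟩ *
          (fischer k g g).re
        = d ^ T * (child v).leafProb (depolarizing d) l *
          ((d * (F.effect v * (depolarizing d).extend d' ρ.mat).trace.re) *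
            (fischer k g g).re) := by
          change _ * (_ * (child v).leafProb (depolarizing d) l) * _ = _
          ring
      _ = ∑ y, d ^ T * (child v).leafProb (depolarizing d) l *
          ((∑ x, ‖p y x‖ ^ 2) * (fischer k g g).re) := by
          rw [hD, Finset.sum_mul, Finset.mul_sum]
      _ ≤ ∑ y, d ^ T * (child v).leafProb (depolarizing d) l *
          (fischer (k + 1) (linForm (p y) * g) (linForm (p y) * g)).re :=
          Finset.sum_le_sum fun y _ =>
            mul_le_mul_of_nonneg_left (le_fischer_linForm_mul _ _ _) (by positivity)
      _ ≤ _ := by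
          refine Finset.sum_le_sum fun y _ => ?_
          obtain ⟨s, hs⟩ := hg.exists_linForm_mul (p y)
          exact ih v l hs

/-- The likelihood ratio at a leaf is bounded below. -/
lemma leafProb_depolarizing_le {T : ℕ} (t : LearningTree d d' T) (l : t.Leaf) (hd : 0 < d) :
    (1 - (T : ℝ) ^ 2 / d) * t.leafProb (depolarizing d) l ≤
      ∫ U, t.leafProb (unitaryChannel U) l ∂(haarUnitary d) := by
  have hd' : (0 : ℝ) < d := Nat.cast_pos.2 hd
  have h := le_integral_mul_leafProb t l (MonomialBound.one (d := d))
  simp only [fischer, map_one, mul_one, Complex.one_re, norm_one, one_pow, one_mul,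
    zero_add] at h
  -- This is d^n / ∏ (d+i) ≥ 1 - n²/d in product form, which also covers a negative left side.
  have hprod : ∀ n : ℕ, (1 - (n : ℝ) ^ 2 / d) * ∏ i ∈ Finset.range n, ((d : ℝ) + i) ≤ d ^ n := by
    intro n
    induction n with
    | zero => simp
    | succ n ih =>
      have hP : 0 ≤ ∏ i ∈ Finset.range n, ((d : ℝ) + i) :=
        Finset.prod_nonneg fun i _ => by positivity
      have h1 : (1 - ((n + 1 : ℕ) : ℝ) ^ 2 / d) * (d + n) ≤ (1 - (n : ℝ) ^ 2 / d) * d := by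
        have h2 : (1 - (n : ℝ) ^ 2 / d) * d - (1 - ((n + 1 : ℕ) : ℝ) ^ 2 / d) * (d + n) =
            n + 1 + (n + 1) ^ 2 * n / d := by
          push_cast
          field_simp
          ring
        have : (0 : ℝ) ≤ n + 1 + (n + 1) ^ 2 * n / d := by positivity
        linarith
      rw [Finset.prod_range_succ, pow_succ]
      calc _ = ((1 - ((n + 1 : ℕ) : ℝ) ^ 2 / d) * (d + n)) *
            ∏ i ∈ Finset.range n, ((d : ℝ) + i) := by ring
        _ ≤ ((1 - (n : ℝ) ^ 2 / d) * d) * ∏ i ∈ Finset.range n, ((d : ℝ) + i) :=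
            mul_le_mul_of_nonneg_right h1 hP
        _ = ((1 - (n : ℝ) ^ 2 / d) * ∏ i ∈ Finset.range n, ((d : ℝ) + i)) * d := by ring
        _ ≤ d ^ n * d := mul_le_mul_of_nonneg_right ih hd'.le
  have hP : 0 < ∏ i ∈ Finset.range T, ((d : ℝ) + i) :=
    Finset.prod_pos fun i _ => by positivity
  refine le_of_mul_le_mul_left (le_trans ?_ h) hP
  calc _ = ((1 - (T : ℝ) ^ 2 / d) * ∏ i ∈ Finset.range T, ((d : ℝ) + i)) *
        t.leafProb (depolarizing d) l := by ring
    _ ≤ _ := mul_le_mul_of_nonneg_right (hprod T) (leafProb_depolarizing_nonneg t l)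

/-- At each leaf the larger of the two likelihoods exceeds the unitary one by at most T²/d times the
depolarizing one, whatever the guess. Both likelihoods sum to one over the leaves. -/
lemma successProb_le {T : ℕ} (t : LearningTree d d' T) (guess : t.Leaf → unitInterval)
    (hd : 0 < d) : t.successProb guess ≤ 1 / 2 + (T : ℝ) ^ 2 / (2 * d) := by
  have hd' : (0 : ℝ) < d := Nat.cast_pos.2 hd
  have hint : ∀ l ∈ Finset.univ, Integrable (fun U => t.leafProb (unitaryChannel U) l)
      (haarUnitary d) := fun l _ => integrable_haarUnitary (continuous_leafProb t l)
  have hU : ∑ l, ∫ U, t.leafProb (unitaryChannel U) l ∂(haarUnitary d) = 1 := by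
    rw [← integral_finsetSum _ hint]
    simp [sum_leafProb (trace_extend_unitaryChannel _)]
  have hD := sum_leafProb trace_extend_depolarizing t
  have hr : (0 : ℝ) ≤ (T : ℝ) ^ 2 / d := by positivity
  have key : ∀ l, t.leafProb (depolarizing d) l * (1 - (guess l : ℝ)) +
      (∫ U, t.leafProb (unitaryChannel U) l ∂(haarUnitary d)) * (guess l : ℝ) ≤
      (∫ U, t.leafProb (unitaryChannel U) l ∂(haarUnitary d)) +
        (T : ℝ) ^ 2 / d * t.leafProb (depolarizing d) l := by
    intro l
    have h1 := leafProb_depolarizing_le t l hd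
    have h2 := leafProb_depolarizing_nonneg t l
    have h3 := (guess l).2.1
    have h4 := (guess l).2.2
    have h5 := mul_le_mul_of_nonneg_right h1 (sub_nonneg.2 h4)
    have h6 := mul_nonneg (mul_nonneg hr h2) h3
    linarith
  have hsum := Finset.sum_le_sum fun l (_ : l ∈ Finset.univ) => key l
  rw [Finset.sum_add_distrib, Finset.sum_add_distrib, ← Finset.mul_sum, hU, hD] at hsum
  rw [successProb, integral_finsetSum _ fun l hl => (hint l hl).mul_const _]
  simp only [integral_mul_const]
  have : (T : ℝ) ^ 2 / (2 * d) = 1 / 2 * ((T : ℝ) ^ 2 / d) := by field_simp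
  rw [this]
  linarith

end LearningTree

theorem mainTheorem4 :
    ∃ c : ℝ, 0 < c ∧
      ∀ (d d' T : ℕ) (t : LearningTree d d' T) (guess : t.Leaf → unitInterval),
        2 / 3 ≤ t.successProb guess → c * Real.sqrt d ≤ T := by
  -- Success 2/3 forces T² ≥ d/3, and (1/2)² ≤ 1/3.
  refine ⟨1 / 2, by norm_num, fun d d' T t guess h => ?_⟩
  rcases d.eq_zero_or_pos with rfl | hd
  · simp
  have hd' : (0 : ℝ) < d := Nat.cast_pos.2 hd
  have h1 := t.successProb_le guess hd
  have h2 : (1 / 3 : ℝ) * d ≤ (T : ℝ) ^ 2 := by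
    rw [← le_div_iff₀ hd']
    have : (T : ℝ) ^ 2 / (2 * d) = 1 / 2 * ((T : ℝ) ^ 2 / d) := by field_simp
    linarith
  refine le_of_sq_le_sq ?_ T.cast_nonneg
  rw [mul_pow, Real.sq_sqrt hd'.le]
  linarith
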